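/- **Theorem (High-Rate 1-Ebit Code).** All matrices are over $\mathbb{F}_2$. Let $2 \le \mu < v$, and let $H$ be a point-by-block incidence matrix of a Steiner $2$-design $S(2,\mu,v)$, that is, of a $v$-set of points with a finite family of $\mu$-subsets (blocks) such that every pair of distinct points lies in exactly one block. Suppose that the replication number $r = \frac{v-1}{\mu-1}$ is odd. Then $HH^T = J$ (the all-one matrix), every row of $H$ has weight $r$, every column of $H$ has weight $\mu$, and the Tanner graph of $H$ has girth $6$. An $[[n,k;c]]$ entanglement-assisted quantum error-correcting code (EAQECC) encodes $k$ logical qubits into $n$ physical qubits by an isometry from the $k$ logical qubits and the sender's halves of $c$ ebits $\frac{1}{\sqrt2}(|00\rangle+|11\rangle)$ into the $n$ physical qubits. It is an EAQECC corresponding to $H$ by the CSS construction if its physical qubits are indexed by the columns of $H$ and, for suitable Pauli operators $g_h, g'_h$ on the receiver's $c$ qubits, its encoded states are exactly the vectors fixed by all the operators $X^h\otimes g_h$ and $Z^h\otimes g'_h$, where $h$ runs over the rows of $H$. Such an $[[n,k;c]]$ EAQECC corresponding to $H$ exists, and every such EAQECC satisfies \[ n = \frac{v(v-1)}{\mu(\mu-1)},\qquad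 c = 1, \] \[ \frac{vr}{\mu}-2v+1 \;\le\; k \;\le\; \frac{vr}{\mu}-2\left\lceil \frac12+\sqrt{\frac14+\frac{(v-1)(v-\mu)}{\mu}}\,\right\rceil+1 . \] -/

import Mathlib

open scoped Kronecker

/-! ## Designs, incidence matrices, Tanner graphs -/

/-- A `2-(v, μ, lam)` design: a set `V` of `v` points with a finite family `blocks` (indexed by
`B`) of `μ`-subsets such that each pair of distinct points lies in exactly `lam` blocks. -/
structure Is2Design {V B : Type*} [Fintype V] [DecidableEq V] [Fintype B]
    (blocks : B → Finset V) (v μ lam : ℕ) : Prop where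
  card_points : Fintype.card V = v
  card_block : ∀ j, (blocks j).card = μ
  card_pair : ∀ x y : V, x ≠ y →
    (Finset.univ.filter fun j => x ∈ blocks j ∧ y ∈ blocks j).card = lam

/-- A Steiner `2`-design `S(2, μ, v)` is a `2-(v, μ, 1)` design. -/
def IsSteiner2Design {V B : Type*} [Fintype V] [DecidableEq V] [Fintype B]
    (blocks : B → Finset V) (μ v : ℕ) : Prop :=
  Is2Design blocks v μ 1

/-- The point-by-block incidence matrix, over the field with two elements. -/
def incidenceMatrix {V B : Type*} [DecidableEq V] (blocks : B → Finset V) :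
    Matrix V B (ZMod 2) :=
  Matrix.of fun x j => if x ∈ blocks j then 1 else 0

/-- The Tanner graph of a parity-check matrix: the bipartite graph on the bits (columns) and the
parity checks (rows), a bit being joined to the checks in which it takes part. -/
def tannerGraph {R N : Type*} (H : Matrix R N (ZMod 2)) : SimpleGraph (N ⊕ R) where
  Adj
    | .inl j, .inr i => H i j ≠ 0
    | .inr i, .inl j => H i j ≠ 0
    | _, _ => False
  symm := ⟨by rintro (j | i) (j' | i') h <;> exact h⟩
  loopless := ⟨by rintro (j | i) h <;> exact h⟩

/-! ## Qubits and Pauli operators -/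

/-- Computational basis labels of a register of qubits indexed by `N`. A vector of the state
space `(ℂ²)^{⊗ N}` is a function `Bits N → ℂ`. -/
abbrev Bits (N : Type*) : Type _ := N → ZMod 2

/-- The operator `X^a Z^b`, sending `|x⟩` to `(-1)^(b ⬝ x) |x + a⟩`. -/
def pauliXZ {N : Type*} [Fintype N] [DecidableEq N] (a b : Bits N) :
    Matrix (Bits N) (Bits N) ℂ :=
  Matrix.of fun y x => if y = x + a then (-1 : ℂ) ^ (b ⬝ᵥ x).val else 0

/-- Membership in the Pauli group: the operators `i^t X^a Z^b`. -/
def IsPauli {N : Type*} [Fintype N] [DecidableEq N] (P : Matrix (Bits N) (Bits N) ℂ) : Prop :=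
  ∃ (t : ℕ) (a b : Bits N), P = Complex.I ^ t • pauliXZ a b

/-! ## Entanglement-assisted codes -/

/-- The state `|Φ⟩^{⊗ c}` of `c` ebits, where `|Φ⟩ = (|00⟩ + |11⟩) / √2`; the first component is
the sender's half, the second component the receiver's half. -/
noncomputable def ebits (c : ℕ) (p : Bits (Fin c) × Bits (Fin c)) : ℂ :=
  if p.1 = p.2 then (((Real.sqrt 2) ^ c : ℝ) : ℂ)⁻¹ else 0

/-- An entanglement-assisted quantum code with physical qubits indexed by `N`, with `k` logical
qubits and `c` ebits. It is given by its encoder, an isometry from the `k` logical qubits and the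
sender's halves of the `c` ebits to the physical qubits (that is, an encoding unitary applied to
these qubits and to ancillas in the state `|0⟩`). -/
structure EAQECC (N : Type*) [Fintype N] [DecidableEq N] (k c : ℕ) where
  encoder : Matrix (Bits N) (Bits (Fin k) × Bits (Fin c)) ℂ
  isometry : encoder.conjTranspose * encoder = 1

namespace EAQECC

variable {N : Type*} [Fintype N] [DecidableEq N] {k c : ℕ}

/-- The length: the number of physical qubits. -/
def length (_C : EAQECC N k c) : ℕ := Fintype.card N

/-- The encoded state `(encoder ⊗ 1) (|ψ⟩ ⊗ |Φ⟩^{⊗ c})` on the physical qubits together with the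
receiver's halves of the ebits. -/
noncomputable def encode (C : EAQECC N k c) (ψ : Bits (Fin k) → ℂ) :
    Bits N × Bits (Fin c) → ℂ :=
  fun p => ∑ w : Bits (Fin k), ∑ a : Bits (Fin c), C.encoder p.1 (w, a) * (ψ w * ebits c (a, p.2))

/-- `C` is the entanglement-assisted CSS code of the (possibly redundant) parity-check matrix `H`:
the operators `X^h` and `Z^h`, for the rows `h` of `H`, which need not commute, are extended by
Pauli operators on the receiver's qubits in such a way that the encoded states are exactly the
vectors fixed by all the extended operators. -/
def IsCSSCodeOf (C : EAQECC N k c) {R : Type*} (H : Matrix R N (ZMod 2)) : Prop :=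
  ∃ gX gZ : R → Matrix (Bits (Fin c)) (Bits (Fin c)) ℂ,
    (∀ i, IsPauli (gX i)) ∧ (∀ i, IsPauli (gZ i)) ∧
    ∀ φ : Bits N × Bits (Fin c) → ℂ,
      (∃ ψ, C.encode ψ = φ) ↔
        ∀ i, (pauliXZ (H i) 0 ⊗ₖ gX i).mulVec φ = φ ∧ (pauliXZ 0 (H i) ⊗ₖ gZ i).mulVec φ = φ

end EAQECC

/-! ### Counting in Steiner 2-designs. -/

section Design

/-! Write `d` for the rank of `H` and `n` for the number of blocks. The theorem reduces to `k + 2d =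
n + c`, to `c = 1`, and to two bounds on `d`.

The extended generators generate a group of order `2^(2d)` fixing the encoded states. All its
nontrivial elements have trace zero, so the trace of the averaging projection gives `2^k = 2^(n+c) /
2^(2d)` (`add_two_mul_rank`). Because `HHᵀ = J`, the receiver's parts of all X-generators agree up
to scalars, likewise for Z, and an X-part anticommutes with a Z-part. This excludes `c = 0`; for `c
≥ 2` some nontrivial Pauli on the receiver's side would commute with everything, although only
scalars there preserve the code (`ebits_eq_one`).

The lower bound on `k` is `d ≤ v`. The upper bound is `d(d - 1) ≥ (v - 1)(v - μ)/μ`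
(`card_flags_le_rank`): the functions on flags with zero row and column sums form the cycle space of
the incidence graph, and `f ↦ H Mᵀ H`, with `M` the matrix of `f`, embeds it into linear maps with
range in that of `H` which kill a space of codimension `d - 1`.

For existence, append a `1` to each row. The extended rows span a self-orthogonal space `L`, and the
uniform superpositions over cosets of `L` in its dual span the code (`exists_isCSSCodeOf`). -/

theorem incidenceMatrix_apply {V B : Type*} [DecidableEq V] {blocks : B → Finset V} (x : V) (j : B) :
    incidenceMatrix blocks x j = if x ∈ blocks j then 1 else 0 := rfl

theorem hammingNorm_incidenceMatrix_row {V B : Type*} [DecidableEq V] [Fintype B]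
    {blocks : B → Finset V} (x : V) :
    hammingNorm (incidenceMatrix blocks x) =
      (Finset.univ.filter fun j => x ∈ blocks j).card := by
  simp [hammingNorm, incidenceMatrix_apply]

theorem hammingNorm_incidenceMatrix_column {V B : Type*} [Fintype V] [DecidableEq V]
    {blocks : B → Finset V} (j : B) :
    hammingNorm ((incidenceMatrix blocks).transpose j) = (blocks j).card := by
  simp [hammingNorm, incidenceMatrix_apply]

variable {V B : Type*} [Fintype V] [DecidableEq V] [Fintype B] {blocks : B → Finset V} {v μ : ℕ}

theorem IsSteiner2Design.eq_of_mem (hD : IsSteiner2Design blocks μ v) {x y : V} (hxy : x ≠ y)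
    {i j : B} (hxi : x ∈ blocks i) (hyi : y ∈ blocks i) (hxj : x ∈ blocks j)
    (hyj : y ∈ blocks j) : i = j := by
  have h := hD.card_pair x y hxy
  exact Finset.card_le_one.1 h.le i (by simp [hxi, hyi]) j (by simp [hxj, hyj])

theorem IsSteiner2Design.exists_block (hD : IsSteiner2Design blocks μ v) {x y : V}
    (hxy : x ≠ y) : ∃ j, x ∈ blocks j ∧ y ∈ blocks j := by
  have h := hD.card_pair x y hxy
  obtain ⟨j, hj⟩ := Finset.card_pos.1 (h.symm ▸ Nat.one_pos)
  exact ⟨j, by simpa using hj⟩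

/-- The number of blocks through a point, times `μ - 1`. -/
theorem IsSteiner2Design.card_through_mul (hD : IsSteiner2Design blocks μ v) (x : V) :
    (Finset.univ.filter fun j => x ∈ blocks j).card * (μ - 1) = v - 1 := by
  have h := Finset.sum_card_bipartiteAbove_eq_sum_card_bipartiteBelow
    (s := Finset.univ.filter fun j => x ∈ blocks j) (t := Finset.univ.erase x)
    (fun j y => y ∈ blocks j)
  have h1 : ∀ j ∈ Finset.univ.filter (fun j => x ∈ blocks j),
      (Finset.bipartiteAbove (fun j y => y ∈ blocks j) (Finset.univ.erase x) j).card = μ - 1 := by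
    intro j hj
    have hj' : x ∈ blocks j := by simpa using hj
    rw [← hD.card_block j, ← Finset.card_erase_of_mem hj']
    congr 1
    ext y
    simp [Finset.mem_bipartiteAbove]
  have h2 : ∀ y ∈ Finset.univ.erase x, (Finset.bipartiteBelow (fun j y => y ∈ blocks j)
      (Finset.univ.filter fun j => x ∈ blocks j) y).card = 1 := by
    intro y hy
    rw [← hD.card_pair x y (Finset.ne_of_mem_erase hy).symm]
    congr 1
    ext j
    simp [Finset.mem_bipartiteBelow]
  rw [Finset.sum_congr rfl h1, Finset.sum_congr rfl h2] at h
  simpa [hD.card_points] using h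

theorem IsSteiner2Design.card_blocks_mul (hD : IsSteiner2Design blocks μ v) {r : ℕ}
    (hr : ∀ x, (Finset.univ.filter fun j => x ∈ blocks j).card = r) :
    Fintype.card B * μ = v * r := by
  have h := Finset.sum_card_bipartiteAbove_eq_sum_card_bipartiteBelow
    (s := (Finset.univ : Finset B)) (t := (Finset.univ : Finset V)) (fun j y => y ∈ blocks j)
  have h1 : ∀ j : B, (Finset.bipartiteAbove (fun j y => y ∈ blocks j) Finset.univ j).card = μ := by
    intro j
    rw [← hD.card_block j]
    congr 1
    ext y
    simp [Finset.mem_bipartiteAbove]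
  have h2 : ∀ y : V, (Finset.bipartiteBelow (fun j y => y ∈ blocks j)
      Finset.univ y).card = r := by
    intro y
    rw [← hr y]
    rfl
  simp only [h1, h2] at h
  simpa [hD.card_points] using h

theorem IsSteiner2Design.incidenceMatrix_mul_transpose (hD : IsSteiner2Design blocks μ v) {r : ℕ}
    (hr : ∀ x, (Finset.univ.filter fun j => x ∈ blocks j).card = r) (hodd : Odd r) :
    incidenceMatrix blocks * (incidenceMatrix blocks).transpose = Matrix.of (fun _ _ => 1) := by
  ext x y
  have h : (incidenceMatrix blocks * (incidenceMatrix blocks).transpose) x y =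
      ((Finset.univ.filter fun j => x ∈ blocks j ∧ y ∈ blocks j).card : ZMod 2) := by
    simp only [Matrix.mul_apply, Matrix.transpose_apply, incidenceMatrix_apply, mul_ite, mul_one,
      mul_zero, ← ite_and, Finset.sum_boole]
    simp only [and_comm]
  rw [h, Matrix.of_apply]
  by_cases hxy : x = y
  · subst hxy
    simp only [and_self, hr]
    exact ZMod.natCast_eq_one_iff_odd.2 hodd
  · rw [hD.card_pair x y hxy, Nat.cast_one]

end Design

/-! ### Girth of the Tanner graph. -/

section Girth

variable {R N : Type*} {H : Matrix R N (ZMod 2)}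

theorem tannerGraph_adj_isLeft {a b : N ⊕ R} (h : (tannerGraph H).Adj a b) :
    a.isLeft = !b.isLeft := by
  rcases a with a | a <;> rcases b with b | b <;> simp_all [tannerGraph]

/-- If two distinct checks never share two distinct bits, every cycle has length at least six. -/
theorem six_le_egirth_tannerGraph
    (hH : ∀ i i' j j', i ≠ i' → H i j ≠ 0 → H i' j ≠ 0 → H i j' ≠ 0 → H i' j' ≠ 0 → j = j') :
    6 ≤ (tannerGraph H).egirth := by
  rw [SimpleGraph.le_egirth]
  intro a w hw
  by_contra hlt
  have h3 := hw.three_le_length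
  have hlt : w.length < 6 := by exact_mod_cast not_le.1 hlt
  have adj : ∀ i < w.length, (tannerGraph H).Adj (w.getVert i) (w.getVert (i + 1)) :=
    fun i hi => w.adj_getVert_succ hi
  have h0 : w.getVert 0 = a := w.getVert_zero
  have hl : w.getVert w.length = a := w.getVert_length
  have side := fun i hi => tannerGraph_adj_isLeft (adj i hi)
  -- Odd lengths contradict bipartiteness; a 4-cycle is a pair of checks sharing two bits.
  obtain h | h | h : w.length = 3 ∨ w.length = 4 ∨ w.length = 5 := by omega
  · have s0 := side 0 (by omega); have s1 := side 1 (by omega); have s2 := side 2 (by omega)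
    rw [h] at hl
    simp only [Nat.reduceAdd, hl, h0, zero_add] at s0 s1 s2
    revert s0 s1 s2
    cases a.isLeft <;> cases (w.getVert 1).isLeft <;> cases (w.getVert 2).isLeft <;> simp
  · have a0 := adj 0 (by omega); have a1 := adj 1 (by omega); have a2 := adj 2 (by omega)
    have a3 := adj 3 (by omega)
    have inj := hw.getVert_injOn'
    have n02 : w.getVert 0 ≠ w.getVert 2 := fun e => by
      have := inj (x₁ := 0) (x₂ := 2) (by simp) (by simp; omega) e
      omega
    have n13 : w.getVert 1 ≠ w.getVert 3 := fun e => by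
      have := inj (x₁ := 1) (x₂ := 3) (by simp; omega) (by simp; omega) e
      omega
    rw [h] at hl
    simp only [Nat.reduceAdd, zero_add] at a0 a1 a2 a3
    rw [show w.getVert 4 = w.getVert 0 from hl.trans h0.symm] at a3
    clear h0 hl side adj inj
    generalize w.getVert 0 = p0 at *
    generalize w.getVert 1 = p1 at *
    generalize w.getVert 2 = p2 at *
    generalize w.getVert 3 = p3 at *
    rcases p0 with p0 | p0 <;> rcases p1 with p1 | p1 <;> rcases p2 with p2 | p2 <;>
      rcases p3 with p3 | p3 <;> simp_all only [tannerGraph, ne_eq, Sum.inl.injEq, Sum.inr.injEq]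
    · exact n02 (hH p1 p3 p0 p2 n13 a0 a3 a1 a2)
    · exact n13 (hH p0 p2 p1 p3 n02 a0 a1 a3 a2)
  · have s0 := side 0 (by omega); have s1 := side 1 (by omega); have s2 := side 2 (by omega)
    have s3 := side 3 (by omega); have s4 := side 4 (by omega)
    rw [h] at hl
    simp only [Nat.reduceAdd, hl, h0, zero_add] at s0 s1 s2 s3 s4
    revert s0 s1 s2 s3 s4
    cases a.isLeft <;> cases (w.getVert 1).isLeft <;> cases (w.getVert 2).isLeft <;>
      cases (w.getVert 3).isLeft <;> cases (w.getVert 4).isLeft <;> simp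

theorem egirth_tannerGraph_le_six {x y z : R} {j₁ j₂ j₃ : N} (hxy : x ≠ y) (hyz : y ≠ z)
    (hzx : z ≠ x) (h12 : j₁ ≠ j₂) (h23 : j₂ ≠ j₃) (h31 : j₃ ≠ j₁)
    (hx1 : H x j₁ ≠ 0) (hy1 : H y j₁ ≠ 0) (hy2 : H y j₂ ≠ 0) (hz2 : H z j₂ ≠ 0)
    (hz3 : H z j₃ ≠ 0) (hx3 : H x j₃ ≠ 0) : (tannerGraph H).egirth ≤ 6 := by
  have a1 : (tannerGraph H).Adj (.inr x) (.inl j₁) := hx1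
  have a2 : (tannerGraph H).Adj (.inl j₁) (.inr y) := hy1
  have a3 : (tannerGraph H).Adj (.inr y) (.inl j₂) := hy2
  have a4 : (tannerGraph H).Adj (.inl j₂) (.inr z) := hz2
  have a5 : (tannerGraph H).Adj (.inr z) (.inl j₃) := hz3
  have a6 : (tannerGraph H).Adj (.inl j₃) (.inr x) := hx3
  have hw : (SimpleGraph.Walk.cons a1 <| .cons a2 <| .cons a3 <| .cons a4 <| .cons a5 <|
      .cons a6 .nil).IsCycle := by
    simp [SimpleGraph.Walk.isCycle_def, SimpleGraph.Walk.isTrail_def, hxy, hyz, hzx, h12, h23,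
      hxy.symm, hzx.symm, h31.symm]
  simpa using hw.egirth_le_length

variable {V B : Type*} [Fintype V] [DecidableEq V] [Fintype B] {blocks : B → Finset V} {v μ : ℕ}

/-- Three points not on a common block, with the blocks joining them in pairs, form a hexagon; two
points on two common blocks would be needed for a 4-cycle. -/
theorem IsSteiner2Design.egirth_tannerGraph (hD : IsSteiner2Design blocks μ v) (hμ : 2 ≤ μ)
    (hv : μ < v) : (tannerGraph (incidenceMatrix blocks)).egirth = 6 := by
  have hH : ∀ x j, incidenceMatrix blocks x j ≠ 0 ↔ x ∈ blocks j := by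
    intro x j; simp [incidenceMatrix_apply]
  apply le_antisymm
  · obtain ⟨x, y, hxy⟩ : ∃ x y : V, x ≠ y :=
      Fintype.one_lt_card_iff.1 (by rw [hD.card_points]; omega)
    obtain ⟨j₁, hx1, hy1⟩ := hD.exists_block hxy
    obtain ⟨z, hz⟩ : ∃ z, z ∉ blocks j₁ := by
      by_contra! hall
      have h1 := hD.card_block j₁
      rw [Finset.eq_univ_iff_forall.2 hall, Finset.card_univ, hD.card_points] at h1
      omega
    have hyz : y ≠ z := fun h => hz (h ▸ hy1)
    have hzx : z ≠ x := fun h => hz (h ▸ hx1)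
    obtain ⟨j₂, hy2, hz2⟩ := hD.exists_block hyz
    obtain ⟨j₃, hz3, hx3⟩ := hD.exists_block hzx
    refine egirth_tannerGraph_le_six (j₁ := j₁) (j₂ := j₂) (j₃ := j₃) hxy hyz hzx ?_ ?_ ?_
      ((hH _ _).2 hx1) ((hH _ _).2 hy1) ((hH _ _).2 hy2) ((hH _ _).2 hz2) ((hH _ _).2 hz3)
      ((hH _ _).2 hx3)
    · rintro rfl; exact hz hz2
    · rintro rfl; exact hz ((hD.eq_of_mem hxy hx3 hy2 hx1 hy1) ▸ hz2)
    · rintro rfl; exact hz hz3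
  · refine six_le_egirth_tannerGraph fun x y i j hxy h1 h2 h3 h4 => ?_
    rw [hH] at h1 h2 h3 h4
    exact hD.eq_of_mem hxy h1 h2 h3 h4

end Girth

/-! ### Lower bound on the 2-rank of the incidence matrix. -/

section RankBound

variable {V B : Type*} [Fintype V] [DecidableEq V] [Fintype B] [DecidableEq B]

/-- A space of linear maps that kill `q` and have range in `p` has dimension at most
`codim q * dim p`. -/
theorem finrank_le_mul_of_injective {K Z E F : Type*} [Field K] [AddCommGroup Z] [Module K Z]
    [AddCommGroup E] [Module K E] [FiniteDimensional K E] [AddCommGroup F] [Module K F]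
    [FiniteDimensional K F]
    (T : Z →ₗ[K] E →ₗ[K] F) (hT : Function.Injective T) (q : Submodule K E) (p : Submodule K F)
    (hq : ∀ z, q ≤ LinearMap.ker (T z)) (hp : ∀ z, LinearMap.range (T z) ≤ p) :
    Module.finrank K Z ≤ (Module.finrank K E - Module.finrank K q) * Module.finrank K p := by
  let S : Z →ₗ[K] (E ⧸ q) →ₗ[K] p :=
    { toFun := fun z => q.liftQ ((T z).codRestrict p fun x => hp z ⟨x, rfl⟩) (by
        intro x hx
        rw [LinearMap.mem_ker]
        exact Subtype.ext (hq z hx))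
      map_add' := fun a b => by
        apply Submodule.linearMap_qext
        ext x
        simp
      map_smul' := fun a b => by
        apply Submodule.linearMap_qext
        ext x
        simp }
  have hS : Function.Injective S := by
    intro a b hab
    apply hT
    ext x
    have := congrArg (fun f : (E ⧸ q) →ₗ[K] p => (f (Submodule.Quotient.mk x) : F)) hab
    simpa [S] using this
  have h := LinearMap.finrank_le_finrank_of_injective hS
  rwa [Module.finrank_linearMap, Submodule.finrank_quotient] at h

/-- Row sums and column sums of a function on the flags. -/
def flagSums (blocks : B → Finset V) :
    ({p : V × B // p.1 ∈ blocks p.2} → ZMod 2) →ₗ[ZMod 2] (V → ZMod 2) × (B → ZMod 2) where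
  toFun f := (fun x => ∑ p, if p.1.1 = x then f p else 0,
    fun j => ∑ p, if p.1.2 = j then f p else 0)
  map_add' f g := by
    ext <;> simp [← Finset.sum_add_distrib, ← ite_add_zero]
  map_smul' a f := by
    ext <;> simp [Finset.mul_sum]

/-- The matrix supported on the flags with given entries. -/
def flagMatrix {V B : Type*} [DecidableEq V] (blocks : B → Finset V) :
    ({p : V × B // p.1 ∈ blocks p.2} → ZMod 2) →ₗ[ZMod 2] Matrix V B (ZMod 2) where
  toFun f := Matrix.of fun x j => if h : x ∈ blocks j then f ⟨(x, j), h⟩ else 0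
  map_add' f g := by
    ext x j; by_cases h : x ∈ blocks j <;> simp [h]
  map_smul' a f := by
    ext x j; by_cases h : x ∈ blocks j <;> simp [h]

theorem sum_flags {V B : Type*} [Fintype V] [DecidableEq V] [Fintype B]
    (blocks : B → Finset V) (f : V → B → ZMod 2) :
    ∑ p : {p : V × B // p.1 ∈ blocks p.2}, f p.1.1 p.1.2 =
      ∑ x, ∑ j, if x ∈ blocks j then f x j else 0 := by
  rw [← Fintype.sum_prod_type' (f := fun x j => if x ∈ blocks j then f x j else 0),
    ← Finset.sum_filter]
  exact (Finset.sum_subtype (Finset.univ.filter fun p : V × B => p.1 ∈ blocks p.2)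
    (by simp) (fun p : V × B => f p.1 p.2)).symm

theorem flagMatrix_apply_flag {V B : Type*} [DecidableEq V] {blocks : B → Finset V}
    (f : {p : V × B // p.1 ∈ blocks p.2} → ZMod 2) (p : {p : V × B // p.1 ∈ blocks p.2}) :
    flagMatrix blocks f p.1.1 p.1.2 = f p :=
  dif_pos p.2

/-- Each block contributes `μ` flags. -/
theorem card_flags {V B : Type*} [Fintype V] [DecidableEq V] [Fintype B]
    {blocks : B → Finset V} {μ : ℕ} (h : ∀ j, (blocks j).card = μ) :
    Fintype.card {p : V × B // p.1 ∈ blocks p.2} = Fintype.card B * μ := by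
  let e : {p : V × B // p.1 ∈ blocks p.2} ≃ Σ j, {x // x ∈ blocks j} :=
    { toFun := fun p => ⟨p.1.2, p.1.1, p.2⟩
      invFun := fun q => ⟨(q.2.1, q.1), q.2.2⟩
      left_inv := fun _ => rfl
      right_inv := fun _ => rfl }
  rw [Fintype.card_congr e, Fintype.card_sigma]
  simp [h]

/-- The row sums and the column sums have the same total, so the range of `flagSums` lies in the
hyperplane `ker σ`; this is the source of the `+ 1`. -/
theorem finrank_ker_flagSums (blocks : B → Finset V) [Nonempty B] :
    Fintype.card {p : V × B // p.1 ∈ blocks p.2} + 1 ≤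
      Module.finrank (ZMod 2) (LinearMap.ker (flagSums blocks)) +
        (Fintype.card V + Fintype.card B) := by
  let σ : (V → ZMod 2) × (B → ZMod 2) →ₗ[ZMod 2] ZMod 2 :=
    (Fintype.linearCombination (ZMod 2) (fun _ : V => (1 : ZMod 2))).coprod
      (Fintype.linearCombination (ZMod 2) (fun _ : B => (1 : ZMod 2)))
  have hσ : Function.Surjective σ := by
    intro a
    obtain ⟨j⟩ := ‹Nonempty B›
    exact ⟨(0, Pi.single j a), by simp [σ, Fintype.linearCombination_apply]⟩
  have hle : LinearMap.range (flagSums blocks) ≤ LinearMap.ker σ := by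
    rintro _ ⟨f, rfl⟩
    rw [LinearMap.mem_ker]
    simp only [flagSums, LinearMap.coe_mk, AddHom.coe_mk, σ, LinearMap.coprod_apply,
      Fintype.linearCombination_apply, smul_eq_mul, mul_one]
    rw [Finset.sum_comm, Finset.sum_comm (s := (Finset.univ : Finset B))]
    simp [CharTwo.add_self_eq_zero]
  have h1 := LinearMap.finrank_range_add_finrank_ker (flagSums blocks)
  have h2 := LinearMap.finrank_range_add_finrank_ker σ
  rw [LinearMap.range_eq_top.2 hσ, finrank_top, Module.finrank_prod] at h2
  have h3 := Submodule.finrank_mono hle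
  simp only [Module.finrank_fintype_fun_eq_card, Module.finrank_self] at h1 h2
  omega

variable {blocks : B → Finset V} {v μ : ℕ}

/-- At a flag `(y, i)` the entry sums `f` over the flags `(x, j)` with `y ∈ j` and `x ∈ i`. If `x ≠
y`, both blocks contain both points, so `j = i`. What remains is row `y` together with column `i`,
whose sums vanish, corrected by their common flag `(y, i)`. -/
theorem IsSteiner2Design.mul_flagMatrix_mul_apply (hD : IsSteiner2Design blocks μ v)
    {f : {p : V × B // p.1 ∈ blocks p.2} → ZMod 2} (hf : flagSums blocks f = 0)
    (q : {p : V × B // p.1 ∈ blocks p.2}) :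
    (incidenceMatrix blocks * (flagMatrix blocks f).transpose * incidenceMatrix blocks)
      q.1.1 q.1.2 = f q := by
  obtain ⟨⟨y, i⟩, hq⟩ := q
  dsimp only at hq ⊢
  have hf1 : (∑ p, if p.1.1 = y then f p else 0) = 0 := congrFun (congrArg Prod.fst hf) y
  have hf2 : (∑ p, if p.1.2 = i then f p else 0) = 0 := congrFun (congrArg Prod.snd hf) i
  have hexp : (incidenceMatrix blocks * (flagMatrix blocks f).transpose * incidenceMatrix blocks)
      y i = ∑ p, incidenceMatrix blocks y p.1.2 * f p * incidenceMatrix blocks p.1.1 i := by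
    have := sum_flags blocks (fun x j => incidenceMatrix blocks y j * flagMatrix blocks f x j *
      incidenceMatrix blocks x i)
    have e2 : ∀ x j, (if x ∈ blocks j then incidenceMatrix blocks y j * flagMatrix blocks f x j *
        incidenceMatrix blocks x i else 0) = incidenceMatrix blocks y j * flagMatrix blocks f x j *
        incidenceMatrix blocks x i := by
      intro x j
      by_cases h : x ∈ blocks j
      · rw [if_pos h]
      · have : flagMatrix blocks f x j = 0 := dif_neg h
        rw [if_neg h, this, mul_zero, zero_mul]
    simp only [flagMatrix_apply_flag, e2] at this
    rw [this]
    simp only [Matrix.mul_apply, Matrix.transpose_apply, Finset.sum_mul]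
  rw [hexp]
  have key : ∀ p : {p : V × B // p.1 ∈ blocks p.2},
      incidenceMatrix blocks y p.1.2 * f p * incidenceMatrix blocks p.1.1 i =
      (if p.1.1 = y then f p else 0) + (if p.1.2 = i then f p else 0) +
        (if p = ⟨(y, i), hq⟩ then f p else 0) := by
    rintro ⟨⟨x, j⟩, h⟩
    dsimp only at h ⊢
    simp only [incidenceMatrix_apply, Subtype.mk.injEq, Prod.mk.injEq]
    by_cases hx : x = y
    · subst hx
      by_cases hj : j = i
      · subst hj
        simp only [h, if_true, and_self, one_mul, mul_one]
        rw [CharTwo.add_self_eq_zero, zero_add]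
      · simp [h, hj, hq]
    · by_cases hj : j = i
      · subst hj
        simp [h, hx, hq]
      · have : ¬ (y ∈ blocks j ∧ x ∈ blocks i) := fun hh =>
          hj (hD.eq_of_mem hx h hh.1 hh.2 hq)
        simp only [hx, hj, if_false, add_zero, false_and]
        by_cases h1 : y ∈ blocks j
        · have h2 : x ∉ blocks i := fun h2 => this ⟨h1, h2⟩
          simp [h2]
        · simp [h1]
  rw [Finset.sum_congr rfl fun p _ => key p]
  rw [Finset.sum_add_distrib, Finset.sum_add_distrib, hf1, hf2]
  simp

/-- **Hillebrandt's bound**: `d (d - 1)` is at least the cyclomatic number of the incidence graph,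
where `d` is the rank. -/
theorem IsSteiner2Design.card_flags_le_rank (hD : IsSteiner2Design blocks μ v) [Nonempty V]
    [Nonempty B] {r : ℕ}
    (hr : ∀ x, (Finset.univ.filter fun j => x ∈ blocks j).card = r) (hodd : Odd r) :
    1 ≤ (incidenceMatrix blocks).rank ∧
    Fintype.card B * μ + 1 ≤ ((incidenceMatrix blocks).rank - 1) * (incidenceMatrix blocks).rank +
      (Fintype.card V + Fintype.card B) := by
  set H := incidenceMatrix blocks with hH
  have hJ := hD.incidenceMatrix_mul_transpose hr hodd
  obtain ⟨y⟩ := ‹Nonempty V›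
  have hw : H.mulVec (H y) = 1 := by
    ext x
    exact congrFun (congrFun hJ x) y
  have hwker : H y ∉ LinearMap.ker H.mulVecLin := by
    rw [LinearMap.mem_ker, Matrix.mulVecLin_apply, hw]
    exact fun h => one_ne_zero (congrFun h y)
  have hrank : Module.finrank (ZMod 2) (LinearMap.range H.mulVecLin) = H.rank := rfl
  have hrn := LinearMap.finrank_range_add_finrank_ker H.mulVecLin
  rw [hrank, Module.finrank_fintype_fun_eq_card] at hrn
  -- Adjoining the row `H y` to the kernel improves the bound from `d * d` to `(d - 1) * d`.
  have hlt : Module.finrank (ZMod 2) (LinearMap.ker H.mulVecLin) <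
      Module.finrank (ZMod 2)
        ↥(LinearMap.ker H.mulVecLin ⊔ Submodule.span (ZMod 2) {H y}) := by
    apply Submodule.finrank_lt_finrank_of_lt
    exact lt_of_le_of_ne le_sup_left fun h => hwker (by
      rw [h]; exact Submodule.mem_sup_right (Submodule.mem_span_singleton_self _))
  have hle := Submodule.finrank_le (LinearMap.ker H.mulVecLin ⊔ Submodule.span (ZMod 2) {H y})
  rw [Module.finrank_fintype_fun_eq_card] at hle
  let T : LinearMap.ker (flagSums blocks) →ₗ[ZMod 2] (B → ZMod 2) →ₗ[ZMod 2] (V → ZMod 2) :=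
    { toFun := fun f => (H * (flagMatrix blocks f.1).transpose * H).mulVecLin
      map_add' := fun f g => by
        rw [← Matrix.mulVecLin_add]
        simp [Matrix.mul_add, Matrix.add_mul]
      map_smul' := fun a f => by
        ext : 3
        simp }
  have hT : Function.Injective T := by
    rw [← LinearMap.ker_eq_bot, Submodule.eq_bot_iff]
    intro f hf
    have hz : H * (flagMatrix blocks f.1).transpose * H = 0 := by
      apply Matrix.toLin'.injective
      rw [Matrix.toLin'_apply', map_zero]
      exact hf
    ext q
    rw [← hD.mul_flagMatrix_mul_apply f.2 q, ← hH, hz]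
    rfl
  have hmain := finrank_le_mul_of_injective T hT
    (LinearMap.ker H.mulVecLin ⊔ Submodule.span (ZMod 2) {H y}) (LinearMap.range H.mulVecLin)
    (by
      intro f
      refine sup_le ?_ ?_
      · intro u hu
        rw [LinearMap.mem_ker, Matrix.mulVecLin_apply] at hu
        simp [T, hu]
      · rw [Submodule.span_le, Set.singleton_subset_iff, SetLike.mem_coe, LinearMap.mem_ker]
        -- `H` sends `H y` to the all-one vector, which the vanishing column sums then kill.
        have h1 : (flagMatrix blocks f.1).transpose.mulVec 1 = 0 := by
          ext j
          have hf2 : (∑ p, if p.1.2 = j then f.1 p else 0) = 0 :=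
            congrFun (congrArg Prod.snd f.2) j
          rw [Pi.zero_apply, ← hf2]
          simp only [← flagMatrix_apply_flag f.1]
          rw [sum_flags blocks fun x i => if i = j then flagMatrix blocks f.1 x i else 0]
          simp only [Matrix.mulVec, dotProduct, Matrix.transpose_apply, Pi.one_apply, mul_one]
          refine Finset.sum_congr rfl fun x _ => ?_
          rw [Finset.sum_eq_single j]
          · by_cases h : x ∈ blocks j
            · simp [h]
            · rw [if_neg h]; exact dif_neg h
          · intro i _ hij
            simp [hij]
          · simp
        change (H * (flagMatrix blocks f.1).transpose * H).mulVec (H y) = 0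
        rw [← Matrix.mulVec_mulVec, hw, ← Matrix.mulVec_mulVec, h1, Matrix.mulVec_zero])
    (by
      rintro f _ ⟨u, rfl⟩
      exact ⟨((flagMatrix blocks f.1).transpose * H).mulVec u, by
        change H.mulVec _ = (H * (flagMatrix blocks f.1).transpose * H).mulVec u
        rw [Matrix.mulVec_mulVec, Matrix.mul_assoc]⟩)
  have hflags : Fintype.card {p : V × B // p.1 ∈ blocks p.2} = Fintype.card B * μ :=
    card_flags hD.card_block
  have hcyc := finrank_ker_flagSums blocks
  rw [hrank, Module.finrank_fintype_fun_eq_card] at hmain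
  have hd : Fintype.card B - Module.finrank (ZMod 2)
        ↥(LinearMap.ker H.mulVecLin ⊔ Submodule.span (ZMod 2) {H y}) ≤ H.rank - 1 := by omega
  have := Nat.mul_le_mul_right H.rank hd
  constructor <;> omega

end RankBound

/-! ### Algebra of Pauli operators. -/

section Pauli

/-- The sign `(-1)^t`. -/
noncomputable def bitSign (t : ZMod 2) : ℂ := (-1) ^ t.val

theorem bitSign_zero : bitSign 0 = 1 := by simp [bitSign]

theorem bitSign_one : bitSign 1 = -1 := by
  rw [bitSign, show (1 : ZMod 2).val = 1 from rfl, pow_one]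

theorem zmod_two_eq_zero_or_one (t : ZMod 2) : t = 0 ∨ t = 1 := by
  revert t; decide

theorem bitSign_add (s t : ZMod 2) : bitSign (s + t) = bitSign s * bitSign t := by
  obtain rfl | rfl := zmod_two_eq_zero_or_one s <;> obtain rfl | rfl := zmod_two_eq_zero_or_one t
  · simp [bitSign_zero]
  · simp [bitSign_zero]
  · simp [bitSign_zero]
  · rw [CharTwo.add_self_eq_zero, bitSign_zero, bitSign_one]; norm_num

theorem bitSign_mul_self (t : ZMod 2) : bitSign t * bitSign t = 1 := by
  rw [← bitSign_add, CharTwo.add_self_eq_zero, bitSign_zero]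

variable {N : Type*} [Fintype N] [DecidableEq N]

theorem pauliXZ_apply (a b : Bits N) (y x : Bits N) :
    pauliXZ a b y x = if y = x + a then bitSign (b ⬝ᵥ x) else 0 := rfl

theorem pauliXZ_mul (a b a' b' : Bits N) :
    pauliXZ a b * pauliXZ a' b' = bitSign (b ⬝ᵥ a') • pauliXZ (a + a') (b + b') := by
  ext y x
  rw [Matrix.mul_apply, Finset.sum_eq_single (x + a')]
  · simp only [pauliXZ_apply, Matrix.smul_apply, if_true, smul_eq_mul, ite_mul, mul_ite, zero_mul,
      mul_zero]
    have : x + a' + a = x + (a + a') := by abel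
    rw [this, dotProduct_add, add_dotProduct, bitSign_add, bitSign_add]
    split_ifs
    · ring
    · rfl
  · intro z _ hz
    simp [pauliXZ_apply, hz]
  · simp

theorem pauliXZ_zero : pauliXZ (0 : Bits N) 0 = 1 := by
  ext y x
  simp [pauliXZ_apply, Matrix.one_apply, bitSign_zero]

theorem bits_add_self {M : Type*} (a : Bits M) : a + a = 0 := by
  ext j
  exact CharTwo.add_self_eq_zero (a j)

theorem pauliXZ_mul_self (a b : Bits N) :
    pauliXZ a b * pauliXZ a b = bitSign (b ⬝ᵥ a) • 1 := by
  rw [pauliXZ_mul, bits_add_self, bits_add_self, pauliXZ_zero]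

theorem pauliXZ_commute {a b a' b' : Bits N} (h : b ⬝ᵥ a' = b' ⬝ᵥ a) :
    pauliXZ a b * pauliXZ a' b' = pauliXZ a' b' * pauliXZ a b := by
  rw [pauliXZ_mul, pauliXZ_mul, h, add_comm a, add_comm b]

/-- Translation by a unit vector in the support of `b` changes the sign of every term. -/
theorem sum_bitSign_dotProduct {b : Bits N} (hb : b ≠ 0) :
    ∑ x : Bits N, bitSign (b ⬝ᵥ x) = 0 := by
  obtain ⟨j, hj⟩ := Function.ne_iff.1 hb
  have hj : b j = 1 := (zmod_two_eq_zero_or_one _).resolve_left hj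
  have h := Equiv.sum_comp (Equiv.addRight (Pi.single j 1 : Bits N)) (fun x => bitSign (b ⬝ᵥ x))
  simp only [Equiv.coe_addRight, dotProduct_add, bitSign_add, dotProduct_single, hj, mul_one,
    bitSign_one, mul_neg, Finset.sum_neg_distrib] at h
  exact self_eq_neg.1 h.symm

theorem trace_pauliXZ {a b : Bits N} (h : a ≠ 0 ∨ b ≠ 0) : (pauliXZ a b).trace = 0 := by
  simp only [Matrix.trace, Matrix.diag, pauliXZ_apply]
  by_cases ha : a = 0
  · subst ha
    simp only [add_zero, if_true]
    exact sum_bitSign_dotProduct (h.resolve_left (by simp))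
  · simp [ha]

/-- Trace zero would force the scalar to be `0`, but a Pauli operator squares to `±1`. -/
theorem pauliXZ_ne_smul_one {a b : Bits N} (h : a ≠ 0 ∨ b ≠ 0) (t : ℂ) :
    pauliXZ a b ≠ t • 1 := by
  intro he
  have h1 := trace_pauliXZ h
  rw [he, Matrix.trace_smul, Matrix.trace_one, smul_eq_mul, mul_eq_zero] at h1
  have ht : t = 0 := h1.resolve_right (by simp)
  have h2 := pauliXZ_mul_self a b
  rw [he, ht, zero_smul, mul_zero] at h2
  have h3 := congrFun (congrFun h2 0) 0
  simp only [Matrix.zero_apply, Matrix.smul_apply, Matrix.one_apply_eq, bitSign, smul_eq_mul,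
    mul_one] at h3
  exact pow_ne_zero _ (by norm_num) h3.symm

end Pauli

/-! ### Encoded states and operators on the receiver's side. -/

namespace EAQECC

variable {N : Type*} [Fintype N] [DecidableEq N] {k c : ℕ} (C : EAQECC N k c)

/-- The normalisation of the ebits. -/
noncomputable def ebitScale (c : ℕ) : ℂ := (((Real.sqrt 2) ^ c : ℝ) : ℂ)⁻¹

theorem ebitScale_ne_zero (c : ℕ) : ebitScale c ≠ 0 := by
  simp [ebitScale]

theorem encode_apply (ψ : Bits (Fin k) → ℂ) (z : Bits N) (b : Bits (Fin c)) :
    C.encode ψ (z, b) = ebitScale c * ∑ w, C.encoder z (w, b) * ψ w := by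
  rw [encode, Finset.mul_sum]
  refine Finset.sum_congr rfl fun w _ => ?_
  rw [Finset.sum_eq_single b]
  · simp only [ebits, if_true, ebitScale]; ring
  · intro a _ ha
    simp [ebits, ha]
  · simp

theorem encoder_mulVec_injective : Function.Injective C.encoder.mulVec := by
  intro s t h
  have := congrArg C.encoder.conjTranspose.mulVec h
  simpa [Matrix.mulVec_mulVec, C.isometry] using this

theorem encode_apply_eq_mulVec (ψ : Bits (Fin k) → ℂ) (z : Bits N) (b : Bits (Fin c)) :
    C.encode ψ (z, b) =
      ebitScale c * C.encoder.mulVec (fun p => if p.2 = b then ψ p.1 else 0) z := by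
  rw [encode_apply, Matrix.mulVec, dotProduct, Fintype.sum_prod_type]
  simp

/-- Through the ebits, an operator on the receiver's half acts on the sender's half, that is, on the
input of the encoder. Injectivity of the encoder then recovers the entries of `g`. -/
theorem one_kronecker_mulVec_encode (g : Matrix (Bits (Fin c)) (Bits (Fin c)) ℂ)
    (ψ : Bits (Fin k) → ℂ) (z : Bits N) (b : Bits (Fin c)) :
    ((1 : Matrix (Bits N) (Bits N) ℂ) ⊗ₖ g).mulVec (C.encode ψ) (z, b) =
      ebitScale c * C.encoder.mulVec (fun p => g b p.2 * ψ p.1) z := by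
  rw [Matrix.mulVec, dotProduct, Fintype.sum_prod_type, Finset.sum_eq_single z]
  · simp only [Matrix.kroneckerMap_apply, Matrix.one_apply_eq, one_mul, encode_apply, Matrix.mulVec,
      dotProduct, Fintype.sum_prod_type, Finset.mul_sum]
    rw [Finset.sum_comm]
    refine Finset.sum_congr rfl fun w _ => Finset.sum_congr rfl fun b' _ => ?_
    ring
  · intro z' _ hz
    simp [Matrix.kroneckerMap_apply, Matrix.one_apply_ne hz.symm]
  · simp

/-- An operator on the receiver's qubits that preserves the encoded states is a scalar. -/
theorem eq_smul_one_of_preserves {g : Matrix (Bits (Fin c)) (Bits (Fin c)) ℂ}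
    (h : ∀ ψ, ∃ ψ', ((1 : Matrix (Bits N) (Bits N) ℂ) ⊗ₖ g).mulVec (C.encode ψ) = C.encode ψ') :
    ∃ t : ℂ, g = t • 1 := by
  -- With all logical amplitudes equal to 1, the coefficient at `(0, b')` of the encoder's input is
  -- the entry `g b b'` itself.
  obtain ⟨ψ', hψ⟩ := h 1
  refine ⟨ψ' 0, ?_⟩
  ext b b'
  have h1 : C.encoder.mulVec (fun p => g b p.2 * (1 : Bits (Fin k) → ℂ) p.1) =
      C.encoder.mulVec (fun p => if p.2 = b then ψ' p.1 else 0) := by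
    ext z
    have := congrFun hψ (z, b)
    rw [one_kronecker_mulVec_encode, encode_apply_eq_mulVec] at this
    exact mul_left_cancel₀ (ebitScale_ne_zero c) this
  have h2 := congrFun (C.encoder_mulVec_injective h1) (0, b')
  simp only [Pi.one_apply, mul_one] at h2
  rw [h2, Matrix.smul_apply, Matrix.one_apply]
  simp [eq_comm]

/-- Operators on the receiver's qubits that agree on the encoded states are equal. -/
theorem eq_of_agree {g g' : Matrix (Bits (Fin c)) (Bits (Fin c)) ℂ}
    (h : ∀ ψ, ((1 : Matrix (Bits N) (Bits N) ℂ) ⊗ₖ g).mulVec (C.encode ψ) =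
      ((1 : Matrix (Bits N) (Bits N) ℂ) ⊗ₖ g').mulVec (C.encode ψ)) : g = g' := by
  ext b b'
  have h1 : C.encoder.mulVec (fun p => g b p.2 * (1 : Bits (Fin k) → ℂ) p.1) =
      C.encoder.mulVec (fun p => g' b p.2 * (1 : Bits (Fin k) → ℂ) p.1) := by
    ext z
    have := congrFun (h 1) (z, b)
    rw [one_kronecker_mulVec_encode, one_kronecker_mulVec_encode] at this
    exact mul_left_cancel₀ (ebitScale_ne_zero c) this
  simpa using congrFun (C.encoder_mulVec_injective h1) (0, b')

/-- The encoding as a linear map. -/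
noncomputable def encodeLin : (Bits (Fin k) → ℂ) →ₗ[ℂ] (Bits N × Bits (Fin c) → ℂ) where
  toFun := C.encode
  map_add' ψ ψ' := by
    ext ⟨z, b⟩
    simp [encode_apply, mul_add, Finset.sum_add_distrib]
  map_smul' t ψ := by
    ext ⟨z, b⟩
    simp only [encode_apply, Pi.smul_apply, smul_eq_mul, RingHom.id_apply, Finset.mul_sum]
    refine Finset.sum_congr rfl fun w _ => ?_
    ring

theorem encodeLin_injective : Function.Injective C.encodeLin := by
  intro ψ ψ' h
  ext w
  have h1 : C.encoder.mulVec (fun p => if p.2 = 0 then ψ p.1 else 0) =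
      C.encoder.mulVec (fun p => if p.2 = 0 then ψ' p.1 else 0) := by
    ext z
    have : C.encode ψ (z, 0) = C.encode ψ' (z, 0) := congrFun h (z, 0)
    rw [encode_apply_eq_mulVec, encode_apply_eq_mulVec] at this
    exact mul_left_cancel₀ (ebitScale_ne_zero c) this
  simpa using congrFun (C.encoder_mulVec_injective h1) (w, 0)

/-- The operator `M` fixes all encoded states. -/
def Fixes (M : Matrix (Bits N × Bits (Fin c)) (Bits N × Bits (Fin c)) ℂ) : Prop :=
  ∀ ψ, M.mulVec (C.encode ψ) = C.encode ψ

variable {C}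

theorem Fixes.mul {M M' : Matrix (Bits N × Bits (Fin c)) (Bits N × Bits (Fin c)) ℂ}
    (h : C.Fixes M) (h' : C.Fixes M') : C.Fixes (M * M') := fun ψ => by
  rw [← Matrix.mulVec_mulVec, h', h]

variable {a b a' b' : Bits N} {g g' : Matrix (Bits (Fin c)) (Bits (Fin c)) ℂ}

theorem Fixes.pauli_mul (h : C.Fixes (pauliXZ a b ⊗ₖ g)) (h' : C.Fixes (pauliXZ a' b' ⊗ₖ g')) :
    C.Fixes (pauliXZ (a + a') (b + b') ⊗ₖ (bitSign (b ⬝ᵥ a') • (g * g'))) := by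
  have := h.mul h'
  rwa [← Matrix.mul_kronecker_mul, pauliXZ_mul, Matrix.smul_kronecker,
    ← Matrix.kronecker_smul] at this

theorem fixes_pauli_zero : C.Fixes (pauliXZ 0 0 ⊗ₖ 1) := fun ψ => by
  rw [pauliXZ_zero, Matrix.one_kronecker_one, Matrix.one_mulVec]

/-- On encoded states `1 ⊗ g` must act as `±(P ⊗ 1)`, where `P` is the physical Pauli operator, and
this does not involve `g`. -/
theorem Fixes.unique (h : C.Fixes (pauliXZ a b ⊗ₖ g)) (h' : C.Fixes (pauliXZ a b ⊗ₖ g')) :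
    g = g' := by
  have key : ∀ g₀ : Matrix (Bits (Fin c)) (Bits (Fin c)) ℂ, C.Fixes (pauliXZ a b ⊗ₖ g₀) →
      ∀ ψ, ((1 : Matrix (Bits N) (Bits N) ℂ) ⊗ₖ g₀).mulVec (C.encode ψ) =
        bitSign (b ⬝ᵥ a) • (pauliXZ a b ⊗ₖ (1 : Matrix (Bits (Fin c)) (Bits (Fin c)) ℂ)).mulVec
          (C.encode ψ) := by
    intro g₀ h₀ ψ
    conv_rhs => rw [← h₀ ψ]
    rw [Matrix.mulVec_mulVec, ← Matrix.mul_kronecker_mul, pauliXZ_mul_self, one_mul,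
      Matrix.smul_kronecker, Matrix.smul_mulVec, smul_smul, bitSign_mul_self, one_smul]
  exact C.eq_of_agree fun ψ => (key g h ψ).trans (key g' h' ψ).symm

end EAQECC

/-! ### The stabilizer group; the values of `k` and `c`. -/

namespace EAQECC

variable {N : Type*} [Fintype N] [DecidableEq N] {k c : ℕ} {C : EAQECC N k c}
  {R : Type*} {H : Matrix R N (ZMod 2)} {gX gZ : R → Matrix (Bits (Fin c)) (Bits (Fin c)) ℂ}

/-- The encoded states are exactly the vectors fixed by the extended operators. -/
def IsStabilizedBy (C : EAQECC N k c) (H : Matrix R N (ZMod 2))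
    (gX gZ : R → Matrix (Bits (Fin c)) (Bits (Fin c)) ℂ) : Prop :=
  ∀ φ : Bits N × Bits (Fin c) → ℂ, (∃ ψ, C.encode ψ = φ) ↔
    ∀ i, (pauliXZ (H i) 0 ⊗ₖ gX i).mulVec φ = φ ∧ (pauliXZ 0 (H i) ⊗ₖ gZ i).mulVec φ = φ

theorem IsStabilizedBy.fixes_X (h : C.IsStabilizedBy H gX gZ) (i : R) :
    C.Fixes (pauliXZ (H i) 0 ⊗ₖ gX i) := fun ψ => (((h _).1 ⟨ψ, rfl⟩) i).1

theorem IsStabilizedBy.fixes_Z (h : C.IsStabilizedBy H gX gZ) (i : R) :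
    C.Fixes (pauliXZ 0 (H i) ⊗ₖ gZ i) := fun ψ => (((h _).1 ⟨ψ, rfl⟩) i).2

/-- Products of generators reach every pair in the row space; signs are absorbed into `g`. -/
theorem IsStabilizedBy.exists_fixes (h : C.IsStabilizedBy H gX gZ) {a b : Bits N}
    (ha : a ∈ Submodule.span (ZMod 2) (Set.range H))
    (hb : b ∈ Submodule.span (ZMod 2) (Set.range H)) : ∃ g, C.Fixes (pauliXZ a b ⊗ₖ g) := by
  have hX : ∃ g, C.Fixes (pauliXZ a 0 ⊗ₖ g) := by
    induction ha using Submodule.span_induction with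
    | mem x hx => obtain ⟨i, rfl⟩ := hx; exact ⟨_, h.fixes_X i⟩
    | zero => exact ⟨_, fixes_pauli_zero⟩
    | add x y _ _ hx hy =>
      obtain ⟨g, hg⟩ := hx
      obtain ⟨g', hg'⟩ := hy
      exact ⟨_, by simpa only [add_zero] using hg.pauli_mul hg'⟩
    | smul t x _ hx =>
      obtain rfl | rfl := zmod_two_eq_zero_or_one t
      · exact ⟨_, by rw [zero_smul]; exact fixes_pauli_zero⟩
      · rwa [one_smul]
  have hZ : ∃ g, C.Fixes (pauliXZ 0 b ⊗ₖ g) := by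
    induction hb using Submodule.span_induction with
    | mem x hx => obtain ⟨i, rfl⟩ := hx; exact ⟨_, h.fixes_Z i⟩
    | zero => exact ⟨_, fixes_pauli_zero⟩
    | add x y _ _ hx hy =>
      obtain ⟨g, hg⟩ := hx
      obtain ⟨g', hg'⟩ := hy
      exact ⟨_, by simpa only [add_zero] using hg.pauli_mul hg'⟩
    | smul t x _ hx =>
      obtain rfl | rfl := zmod_two_eq_zero_or_one t
      · exact ⟨_, by rw [zero_smul]; exact fixes_pauli_zero⟩
      · rwa [one_smul]
  obtain ⟨g, hg⟩ := hX
  obtain ⟨g', hg'⟩ := hZ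
  exact ⟨_, by simpa only [add_zero, zero_add] using hg.pauli_mul hg'⟩

/-- The stabilizer of the encoded states, as a representation of pairs of vectors in the row
space. -/
noncomputable def stabilizerRep (h : C.IsStabilizedBy H gX gZ) :
    Representation ℂ
      (Multiplicative (Submodule.span (ZMod 2) (Set.range H) ×
        Submodule.span (ZMod 2) (Set.range H)))
      (Bits N × Bits (Fin c) → ℂ) where
  toFun s := (pauliXZ s.toAdd.1.1 s.toAdd.2.1 ⊗ₖ
    (h.exists_fixes s.toAdd.1.2 s.toAdd.2.2).choose).mulVecLin
  map_one' := by
    have h1 := (h.exists_fixes (a := 0) (b := 0) (Submodule.zero_mem _)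
      (Submodule.zero_mem _)).choose_spec.unique fixes_pauli_zero
    simp only [toAdd_one, Prod.fst_zero, Prod.snd_zero, Submodule.coe_zero]
    rw [h1, pauliXZ_zero, Matrix.one_kronecker_one, Matrix.mulVecLin_one]
    rfl
  -- By `Fixes.unique` the chosen extensions are forced, hence multiplicative.
  map_mul' s t := by
    rw [Module.End.mul_eq_comp, ← Matrix.mulVecLin_mul]
    congr 1
    have h1 := ((h.exists_fixes s.toAdd.1.2 s.toAdd.2.2).choose_spec).pauli_mul
      (h.exists_fixes t.toAdd.1.2 t.toAdd.2.2).choose_spec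
    rw [← Matrix.mul_kronecker_mul, pauliXZ_mul, Matrix.smul_kronecker, ← Matrix.kronecker_smul]
    rw [← h1.unique (h.exists_fixes (s * t).toAdd.1.2 (s * t).toAdd.2.2).choose_spec]
    rfl

theorem stabilizerRep_apply (h : C.IsStabilizedBy H gX gZ) {a b : Bits N}
    (ha : a ∈ Submodule.span (ZMod 2) (Set.range H))
    (hb : b ∈ Submodule.span (ZMod 2) (Set.range H)) {g : Matrix (Bits (Fin c)) (Bits (Fin c)) ℂ}
    (hg : C.Fixes (pauliXZ a b ⊗ₖ g)) (φ : Bits N × Bits (Fin c) → ℂ) :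
    stabilizerRep h (Multiplicative.ofAdd (⟨a, ha⟩, ⟨b, hb⟩)) φ =
      (pauliXZ a b ⊗ₖ g).mulVec φ := by
  rw [hg.unique (h.exists_fixes ha hb).choose_spec]
  rfl

theorem invariants_stabilizerRep (h : C.IsStabilizedBy H gX gZ) :
    (stabilizerRep h).invariants = LinearMap.range C.encodeLin := by
  apply le_antisymm
  · intro φ hφ
    obtain ⟨ψ, hψ⟩ := (h φ).2 fun i => by
      have hi : H i ∈ Submodule.span (ZMod 2) (Set.range H) := Submodule.subset_span ⟨i, rfl⟩
      constructor
      · rw [← stabilizerRep_apply h hi (Submodule.zero_mem _) (h.fixes_X i)]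
        exact hφ _
      · rw [← stabilizerRep_apply h (Submodule.zero_mem _) hi (h.fixes_Z i)]
        exact hφ _
    exact ⟨ψ, hψ⟩
  · rintro _ ⟨ψ, rfl⟩ s
    exact (h.exists_fixes s.toAdd.1.2 s.toAdd.2.2).choose_spec ψ

/-- The trace of a Kronecker product factors, and a nontrivial physical Pauli operator has trace
zero, whatever the receiver's part. -/
theorem trace_stabilizerRep (h : C.IsStabilizedBy H gX gZ)
    (s : Multiplicative (Submodule.span (ZMod 2) (Set.range H) ×
        Submodule.span (ZMod 2) (Set.range H))) :
    LinearMap.trace ℂ _ (stabilizerRep h s) =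
      if s = 1 then (2 : ℂ) ^ Fintype.card N * 2 ^ c else 0 := by
  split_ifs with hs
  · subst hs
    rw [map_one, LinearMap.trace_one, Module.finrank_fintype_fun_eq_card]
    simp
  · have : stabilizerRep h s = Matrix.toLin' (pauliXZ s.toAdd.1.1 s.toAdd.2.1 ⊗ₖ
      (h.exists_fixes s.toAdd.1.2 s.toAdd.2.2).choose) := rfl
    rw [this, Matrix.trace_toLin'_eq, Matrix.trace_kronecker, trace_pauliXZ, zero_mul]
    by_contra! hcon
    apply hs
    apply Multiplicative.toAdd.injective
    exact Prod.ext (Subtype.ext hcon.1) (Subtype.ext hcon.2)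

/-- The number of logical qubits of an entanglement-assisted CSS code. -/
theorem IsStabilizedBy.add_two_mul_rank [Finite R] (h : C.IsStabilizedBy H gX gZ) :
    k + 2 * H.rank = Fintype.card N + c := by
  classical
  let G := Multiplicative (Submodule.span (ZMod 2) (Set.range H) ×
        Submodule.span (ZMod 2) (Set.range H))
  have : Fintype G := Fintype.ofFinite G
  have hG : (Fintype.card G : ℂ) = 2 ^ H.rank * 2 ^ H.rank := by
    have hS : Nat.card (Submodule.span (ZMod 2) (Set.range H)) = 2 ^ H.rank := by
      rw [Module.natCard_eq_pow_finrank (K := ZMod 2), Nat.card_zmod,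
        Matrix.rank_eq_finrank_span_row]
      rfl
    rw [← Nat.card_eq_fintype_card]
    simp only [G, Nat.card_congr Multiplicative.toAdd, Nat.card_prod, hS]
    push_cast
    rfl
  have hG0 : (Fintype.card G : ℂ) ≠ 0 := by
    rw [hG]
    exact mul_ne_zero (pow_ne_zero _ two_ne_zero) (pow_ne_zero _ two_ne_zero)
  have : Invertible (Fintype.card G : ℂ) := invertibleOfNonzero hG0
  -- The trace of the averaging projection is the dimension of the invariants, here `2^k`; only the
  -- identity contributes to the average.
  have h1 := (stabilizerRep h).isProj_averageMap.trace
  rw [invariants_stabilizerRep, LinearMap.finrank_range_of_inj C.encodeLin_injective,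
    Module.finrank_fintype_fun_eq_card] at h1
  rw [Representation.averageMap, GroupAlgebra.average, map_smul, map_sum, map_smul, map_sum] at h1
  simp only [MonoidAlgebra.of_apply, Representation.asAlgebraHom_single_one,
    trace_stabilizerRep, Finset.sum_ite_eq', Finset.mem_univ, if_true, smul_eq_mul] at h1
  rw [invOf_eq_inv, inv_mul_eq_iff_eq_mul₀ hG0, hG] at h1
  have h2 : 2 ^ (Fintype.card N + c) = 2 ^ (k + 2 * H.rank) := by
    have : ((2 ^ (Fintype.card N + c) : ℕ) : ℂ) = ((2 ^ (k + 2 * H.rank) : ℕ) : ℂ) := by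
      push_cast
      rw [pow_add, h1]
      simp
      ring
    exact_mod_cast this
  exact (Nat.pow_right_injective le_rfl h2).symm

theorem IsStabilizedBy.preserves (h : C.IsStabilizedBy H gX gZ)
    {M : Matrix (Bits N × Bits (Fin c)) (Bits N × Bits (Fin c)) ℂ}
    (hX : ∀ i, (pauliXZ (H i) 0 ⊗ₖ gX i) * M = M * (pauliXZ (H i) 0 ⊗ₖ gX i))
    (hZ : ∀ i, (pauliXZ 0 (H i) ⊗ₖ gZ i) * M = M * (pauliXZ 0 (H i) ⊗ₖ gZ i))
    (ψ : Bits (Fin k) → ℂ) : ∃ ψ', M.mulVec (C.encode ψ) = C.encode ψ' := by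
  obtain ⟨ψ', hψ'⟩ := (h (M.mulVec (C.encode ψ))).2 fun i => by
    rw [Matrix.mulVec_mulVec, Matrix.mulVec_mulVec, hX, hZ, ← Matrix.mulVec_mulVec,
      ← Matrix.mulVec_mulVec, h.fixes_X i, h.fixes_Z i]
    exact ⟨rfl, rfl⟩
  exact ⟨ψ', hψ'.symm⟩

/-- If a physical operator commuting with all generators can be extended to an operator fixing
the encoded states, the extension is by a scalar. -/
theorem IsStabilizedBy.eq_smul_one_of_fixes (h : C.IsStabilizedBy H gX gZ) {a b : Bits N}
    {g : Matrix (Bits (Fin c)) (Bits (Fin c)) ℂ} (hg : C.Fixes (pauliXZ a b ⊗ₖ g))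
    (ha : ∀ i, H i ⬝ᵥ a = 0) (hb : ∀ i, b ⬝ᵥ H i = 0) : ∃ t : ℂ, g = t • 1 := by
  refine C.eq_smul_one_of_preserves fun ψ => ?_
  obtain ⟨ψ', hψ'⟩ := h.preserves
    (M := pauliXZ a b ⊗ₖ (1 : Matrix (Bits (Fin c)) (Bits (Fin c)) ℂ))
    (fun i => by
      rw [← Matrix.mul_kronecker_mul, ← Matrix.mul_kronecker_mul, one_mul, mul_one,
        pauliXZ_commute (by simp [hb])])
    (fun i => by
      rw [← Matrix.mul_kronecker_mul, ← Matrix.mul_kronecker_mul, one_mul, mul_one,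
        pauliXZ_commute (by simp [ha])]) ψ
  refine ⟨bitSign (b ⬝ᵥ a) • ψ', ?_⟩
  have h1 : (1 : Matrix (Bits N) (Bits N) ℂ) ⊗ₖ g = bitSign (b ⬝ᵥ a) •
      ((pauliXZ a b ⊗ₖ (1 : Matrix (Bits (Fin c)) (Bits (Fin c)) ℂ)) * (pauliXZ a b ⊗ₖ g)) := by
    rw [← Matrix.mul_kronecker_mul, pauliXZ_mul_self, one_mul, Matrix.smul_kronecker, smul_smul,
      bitSign_mul_self, one_smul]
  rw [h1, Matrix.smul_mulVec, ← Matrix.mulVec_mulVec, hg ψ, hψ']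
  exact (C.encodeLin.map_smul _ _).symm

/-- A code whose rows all have inner product one uses exactly one ebit. -/
theorem IsStabilizedBy.ebits_eq_one (h : C.IsStabilizedBy H gX gZ) [Nonempty R]
    (hX : ∀ i, IsPauli (gX i)) (hZ : ∀ i, IsPauli (gZ i)) (hH : ∀ i j, H i ⬝ᵥ H j = 1) :
    c = 1 := by
  obtain ⟨o⟩ := ‹Nonempty R›
  have hxx : gX o * gX o = 1 := by
    have h1 := (h.fixes_X o).pauli_mul (h.fixes_X o)
    rw [bits_add_self, bits_add_self, zero_dotProduct, bitSign_zero, one_smul] at h1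
    exact h1.unique fixes_pauli_zero
  have hzz : gZ o * gZ o = 1 := by
    have h1 := (h.fixes_Z o).pauli_mul (h.fixes_Z o)
    rw [bits_add_self, bits_add_self, dotProduct_zero, bitSign_zero, one_smul] at h1
    exact h1.unique fixes_pauli_zero
  -- The physical parts anticommute since a row has inner product 1 with itself; uniqueness passes
  -- the sign to the receiver's parts.
  have hxz : gX o * gZ o = -(gZ o * gX o) := by
    have h1 := (h.fixes_X o).pauli_mul (h.fixes_Z o)
    have h2 := (h.fixes_Z o).pauli_mul (h.fixes_X o)
    rw [zero_dotProduct, bitSign_zero, one_smul, add_zero, zero_add] at h1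
    rw [hH, bitSign_one, neg_smul, one_smul, add_zero, zero_add] at h2
    exact h1.unique h2
  -- `H i + H o` is orthogonal to every row, so its physical operator commutes with all generators.
  have hX' : ∀ i, ∃ t : ℂ, gX i = t • gX o := by
    intro i
    have h1 := (h.fixes_X i).pauli_mul (h.fixes_X o)
    rw [zero_dotProduct, bitSign_zero, one_smul, add_zero] at h1
    obtain ⟨t, ht⟩ := h.eq_smul_one_of_fixes h1
      (fun j => by rw [dotProduct_add, hH, hH]; rfl) (by simp)
    refine ⟨t, ?_⟩
    rw [← mul_one (gX i), ← hxx, ← mul_assoc, ht, Matrix.smul_mul, one_mul]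
  have hZ' : ∀ i, ∃ t : ℂ, gZ i = t • gZ o := by
    intro i
    have h1 := (h.fixes_Z i).pauli_mul (h.fixes_Z o)
    rw [dotProduct_zero, bitSign_zero, one_smul, add_zero] at h1
    obtain ⟨t, ht⟩ := h.eq_smul_one_of_fixes h1 (by simp)
      (fun j => by rw [add_dotProduct, hH, hH]; rfl)
    refine ⟨t, ?_⟩
    rw [← mul_one (gZ i), ← hzz, ← mul_assoc, ht, Matrix.smul_mul, one_mul]
  -- Without ebits the receiver's operators are 1 by 1 matrices, which commute.
  have hc0 : c ≠ 0 := by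
    rintro rfl
    have entry : ∀ A A' : Matrix (Bits (Fin 0)) (Bits (Fin 0)) ℂ,
        (A * A') 0 0 = A 0 0 * A' 0 0 := fun A A' => by
      rw [Matrix.mul_apply, Fintype.sum_subsingleton _ 0]
    have h1 := congrFun (congrFun hxx 0) 0
    have h2 := congrFun (congrFun hzz 0) 0
    have h3 := congrFun (congrFun hxz 0) 0
    rw [entry, Matrix.one_apply_eq] at h1 h2
    rw [Matrix.neg_apply, entry, entry, mul_comm (gZ o 0 0)] at h3
    obtain h4 | h4 := mul_eq_zero.1 (self_eq_neg.1 h3)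
    · rw [h4, zero_mul] at h1
      exact zero_ne_one h1
    · rw [h4, zero_mul] at h2
      exact zero_ne_one h2
  by_contra hc1
  obtain ⟨t₁, a₁, b₁, e₁⟩ := hX o
  obtain ⟨t₂, a₂, b₂, e₂⟩ := hZ o
  -- The symplectic form: its vanishing means that two Pauli operators commute. Commuting with both
  -- `gX o` and `gZ o` is two equations in `2c ≥ 4` unknowns, so a nontrivial solution exists.
  let ω : Bits (Fin c) → Bits (Fin c) → (Bits (Fin c) × Bits (Fin c)) →ₗ[ZMod 2] ZMod 2 :=
    fun a b => (dotProductBilin (ZMod 2) (ZMod 2) b).coprod (dotProductBilin (ZMod 2) (ZMod 2) a)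
  have hker := LinearMap.ker_ne_bot_of_finrank_lt (f := (ω a₁ b₁).prod (ω a₂ b₂)) (by
    simp only [Module.finrank_prod, Module.finrank_fintype_fun_eq_card, Fintype.card_fin,
      Module.finrank_self]
    omega)
  obtain ⟨⟨a, b⟩, hab, hne⟩ := Submodule.exists_mem_ne_zero_of_ne_bot hker
  rw [LinearMap.mem_ker, LinearMap.prod_apply, Prod.mk_eq_zero] at hab
  have hcomm : ∀ a' b' : Bits (Fin c), ω a' b' (a, b) = 0 → ∀ t : ℂ,
      (t • pauliXZ a' b') * pauliXZ a b = pauliXZ a b * (t • pauliXZ a' b') := by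
    intro a' b' h0 t
    rw [Matrix.smul_mul, Matrix.mul_smul, pauliXZ_commute]
    have : b' ⬝ᵥ a + a' ⬝ᵥ b = 0 := h0
    rw [dotProduct_comm b a']
    exact CharTwo.add_eq_zero.1 this
  obtain ⟨t, ht⟩ := C.eq_smul_one_of_preserves (g := pauliXZ a b) (h.preserves
    (fun i => by
      obtain ⟨s, hs⟩ := hX' i
      rw [← Matrix.mul_kronecker_mul, ← Matrix.mul_kronecker_mul, one_mul, mul_one, hs, e₁,
        smul_smul, hcomm _ _ hab.1])
    (fun i => by
      obtain ⟨s, hs⟩ := hZ' i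
      rw [← Matrix.mul_kronecker_mul, ← Matrix.mul_kronecker_mul, one_mul, mul_one, hs, e₂,
        smul_smul, hcomm _ _ hab.2]))
  refine pauliXZ_ne_smul_one ?_ t ht
  by_contra! hcon
  exact hne (Prod.ext hcon.1 hcon.2)

end EAQECC

/-! ### Construction of a code with one ebit. -/

theorem pauliXZ_kronecker_mulVec {M N : Type*} [Fintype M] [DecidableEq M] [Fintype N]
    [DecidableEq N] (a b : Bits M) (a' b' : Bits N) (φ : Bits M × Bits N → ℂ) (p : Bits M × Bits N) :
    (pauliXZ a b ⊗ₖ pauliXZ a' b').mulVec φ p =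
      bitSign (b ⬝ᵥ (p.1 + a) + b' ⬝ᵥ (p.2 + a')) * φ (p + (a, a')) := by
  obtain ⟨y, y'⟩ := p
  have e : ∀ u v : Bits M, u = v + a ↔ v = u + a := by
    intro u v
    constructor <;> rintro rfl <;> rw [add_assoc, bits_add_self, add_zero]
  have e' : ∀ u v : Bits N, u = v + a' ↔ v = u + a' := by
    intro u v
    constructor <;> rintro rfl <;> rw [add_assoc, bits_add_self, add_zero]
  rw [Matrix.mulVec, dotProduct, Fintype.sum_prod_type, Finset.sum_eq_single (y + a),
    Finset.sum_eq_single (y' + a')]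
  · simp [Matrix.kroneckerMap_apply, pauliXZ_apply, add_assoc, bits_add_self, bitSign_add, mul_assoc]
  · intro x' _ hx
    rw [Matrix.kroneckerMap_apply, pauliXZ_apply a' b', if_neg fun h => hx ((e' _ _).1 h), mul_zero,
      zero_mul]
  · simp
  · intro x _ hx
    refine Finset.sum_eq_zero fun x' _ => ?_
    rw [Matrix.kroneckerMap_apply, pauliXZ_apply a b, if_neg fun h => hx ((e _ _).1 h), zero_mul,
      zero_mul]
  · simp

theorem bitSign_eq_one_iff {t : ZMod 2} : bitSign t = 1 ↔ t = 0 := by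
  obtain rfl | rfl := zmod_two_eq_zero_or_one t
  · simp [bitSign_zero]
  · rw [bitSign_one]; norm_num

section OneEbit

variable {R N : Type*} [Fintype N] (H : Matrix R N (ZMod 2))

/-- The rows of the parity-check matrix, extended by a one. -/
def extendedRowSpace : Submodule (ZMod 2) (Bits N × Bits (Fin 1)) :=
  Submodule.span (ZMod 2) (Set.range fun i => (H i, 1))

/-- The vectors orthogonal to all extended rows. -/
def extendedDual : Submodule (ZMod 2) (Bits N × Bits (Fin 1)) where
  carrier := {p | ∀ i, H i ⬝ᵥ p.1 + 1 ⬝ᵥ p.2 = 0}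
  zero_mem' i := by simp
  add_mem' {p q} hp hq i := by
    have := congrArg₂ (· + ·) (hp i) (hq i)
    simp only [add_zero] at this
    simp only [Prod.fst_add, Prod.snd_add, dotProduct_add]
    rw [← this]
    abel
  smul_mem' t p hp i := by
    simp only [Prod.smul_fst, Prod.smul_snd, dotProduct_smul, ← smul_add]
    rw [hp i, smul_zero]

variable {H}

/-- The appended ones contribute `1 + 1 = 0`; this is what makes the extended generators commute. -/
theorem extendedRowSpace_le (hH : ∀ i j, H i ⬝ᵥ H j = 1) :
    extendedRowSpace H ≤ extendedDual H := by
  rw [extendedRowSpace, Submodule.span_le]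
  rintro _ ⟨j, rfl⟩ i
  rw [hH]
  simp
  rfl

/-- Orthogonality to a single extended row determines the last bit. Hence encoder columns for
different sender bits have disjoint supports. -/
theorem snd_eq_of_mem_extendedDual [Nonempty R] {z : Bits N} {b b' : Bits (Fin 1)}
    (h : (z, b) ∈ extendedDual H) (h' : (z, b') ∈ extendedDual H) : b = b' := by
  obtain ⟨o⟩ := ‹Nonempty R›
  have h1 := (h o).trans (h' o).symm
  ext j
  rw [Subsingleton.elim j 0]
  have h2 : ∀ x : Bits (Fin 1), 1 ⬝ᵥ x = x 0 := fun x => by simp [dotProduct]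
  rw [h2, h2] at h1
  exact add_left_cancel h1

/-- The coset labels: a linear surjection from the dual of the extended row space, whose kernel is
the extended row space. -/
theorem exists_cosetLabel (H : Matrix R N (ZMod 2)) :
    ∃ (k : ℕ) (π : extendedDual H →ₗ[ZMod 2] Bits (Fin k)), Function.Surjective π ∧
      ∀ p, π p = 0 ↔ (p : Bits N × Bits (Fin 1)) ∈ extendedRowSpace H := by
  let Q := (extendedRowSpace H).submoduleOf (extendedDual H)
  let e := (Module.finBasis (ZMod 2) (extendedDual H ⧸ Q)).equivFun
  refine ⟨_, e.toLinearMap.comp Q.mkQ, e.surjective.comp Q.mkQ_surjective, fun p => ?_⟩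
  simp only [LinearMap.comp_apply, LinearEquiv.coe_coe, LinearEquiv.map_eq_zero_iff,
    Submodule.mkQ_apply, Submodule.Quotient.mk_eq_zero]
  rfl

/-- The point `p` of the domain of `π` has label `w`. -/
def HasLabel {E : Type*} [AddCommGroup E] [Module (ZMod 2) E] {D : Submodule (ZMod 2) E} {k : ℕ}
    (π : D →ₗ[ZMod 2] Bits (Fin k)) (p : E) (w : Bits (Fin k)) : Prop :=
  ∃ h : p ∈ D, π ⟨p, h⟩ = w

theorem HasLabel.add {E : Type*} [AddCommGroup E] [Module (ZMod 2) E] {D : Submodule (ZMod 2) E}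
    {k : ℕ} {π : D →ₗ[ZMod 2] Bits (Fin k)} {p q : E} {w w' : Bits (Fin k)}
    (h : HasLabel π p w) (h' : HasLabel π q w') : HasLabel π (p + q) (w + w') := by
  obtain ⟨h, rfl⟩ := h
  obtain ⟨h', rfl⟩ := h'
  exact ⟨D.add_mem h h', π.map_add ⟨p, h⟩ ⟨q, h'⟩⟩

variable [DecidableEq N]

open Classical in
/-- All cosets have equally many elements with a given last component. -/
theorem card_hasLabel [Nonempty R] (hH : ∀ i j, H i ⬝ᵥ H j = 1) {k : ℕ}
    {π : extendedDual H →ₗ[ZMod 2] Bits (Fin k)} (hπ : Function.Surjective π)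
    (hker : ∀ p, π p = 0 ↔ (p : Bits N × Bits (Fin 1)) ∈ extendedRowSpace H)
    (w : Bits (Fin k)) (b : Bits (Fin 1)) :
    (Finset.univ.filter fun z => HasLabel π (z, b) w).card =
      (Finset.univ.filter fun z => HasLabel π (z, 0) 0).card := by
  obtain ⟨z₀, hz⟩ : ∃ z₀, HasLabel π (z₀, b) w := by
    obtain ⟨⟨⟨z₁, b₁⟩, h1⟩, h2⟩ := hπ w
    have h3 : HasLabel π (z₁, b₁) w := ⟨h1, h2⟩
    by_cases hb : b₁ = b
    · subst hb; exact ⟨z₁, h3⟩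
    · obtain ⟨o⟩ := ‹Nonempty R›
      -- Adding an extended row flips the last bit and keeps the label.
      have hb' : b₁ + 1 = b := by
        ext j
        have : b₁ 0 ≠ b 0 := fun h => hb (by
          ext j; rw [Subsingleton.elim j 0]; exact h)
        rw [Subsingleton.elim j 0, Pi.add_apply, Pi.one_apply]
        generalize b₁ 0 = s at this
        generalize b 0 = t at this
        revert s t
        decide
      have hmem : (H o, (1 : Bits (Fin 1))) ∈ extendedRowSpace H := Submodule.subset_span ⟨o, rfl⟩
      have h4 := h3.add ⟨extendedRowSpace_le hH hmem, (hker _).2 hmem⟩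
      rw [Prod.mk_add_mk, hb', add_zero] at h4
      exact ⟨_, h4⟩
  refine Finset.card_bij (fun z _ => z + z₀) ?_ ?_ ?_
  · simp only [Finset.mem_filter, Finset.mem_univ, true_and]
    intro z h
    have h1 := h.add hz
    rwa [Prod.mk_add_mk, bits_add_self, bits_add_self] at h1
  · intro z _ z' _ h
    exact add_right_cancel h
  · simp only [Finset.mem_filter, Finset.mem_univ, true_and]
    intro z h
    refine ⟨z + z₀, ?_, by rw [add_assoc, bits_add_self, add_zero]⟩
    have h1 := h.add hz
    rwa [Prod.mk_add_mk, zero_add, zero_add] at h1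

open Classical in
/-- If all rows have pairwise inner product one, a code with a single ebit exists. -/
theorem exists_isCSSCodeOf [Nonempty R] (hH : ∀ i j, H i ⬝ᵥ H j = 1) :
    ∃ (k c : ℕ) (C : EAQECC N k c), C.IsCSSCodeOf H := by
  obtain ⟨k, π, hπ, hker⟩ := exists_cosetLabel H
  have hLle := extendedRowSpace_le hH
  have hrow : ∀ i, (H i, (1 : Bits (Fin 1))) ∈ extendedRowSpace H :=
    fun i => Submodule.subset_span ⟨i, rfl⟩
  have hP : ∀ z (q q' : Bits (Fin k) × Bits (Fin 1)), HasLabel π (z, q.2) q.1 →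
      HasLabel π (z, q'.2) q'.1 → q = q' := by
    rintro z ⟨w, b⟩ ⟨w', b'⟩ ⟨h1, h2⟩ ⟨h3, h4⟩
    dsimp only at h1 h2 h3 h4
    obtain rfl := snd_eq_of_mem_extendedDual h1 h3
    rw [← h2, ← h4]
  obtain ⟨m, hm, hcount⟩ : ∃ m : ℕ, 0 < m ∧ ∀ q : Bits (Fin k) × Bits (Fin 1),
      (Finset.univ.filter fun z => HasLabel π (z, q.2) q.1).card = m :=
    ⟨_, Finset.card_pos.2 ⟨0, Finset.mem_filter.2 ⟨Finset.mem_univ _, Submodule.zero_mem _,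
      π.map_zero⟩⟩, fun q => card_hasLabel hH hπ hker q.1 q.2⟩
  -- Every encoder column is to be supported on `m` basis states with equal amplitude, so `1/√m`
  -- normalises it.
  obtain ⟨t, ht_def⟩ : ∃ t : ℂ, t = ((Real.sqrt m : ℝ) : ℂ)⁻¹ := ⟨_, rfl⟩
  have ht : (m : ℂ) * (t * t) = 1 := by
    have h1 : ((Real.sqrt m : ℝ) : ℂ) * (Real.sqrt m : ℝ) = m := by
      rw [← Complex.ofReal_mul, Real.mul_self_sqrt (Nat.cast_nonneg m), Complex.ofReal_natCast]
    have h2 : (m : ℂ) ≠ 0 := Nat.cast_ne_zero.2 hm.ne'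
    rw [ht_def, ← mul_inv, h1, mul_inv_cancel₀ h2]
  have ht0 : t ≠ 0 := by
    intro h
    rw [h] at ht
    simp at ht
  have hts : star t = t := by
    simp [ht_def]
  let C : EAQECC N k 1 :=
    { encoder := Matrix.of fun z q => if HasLabel π (z, q.2) q.1 then t else 0
      isometry := by
        ext q q'
        simp only [Matrix.mul_apply, Matrix.conjTranspose_apply, Matrix.of_apply, Matrix.one_apply]
        split_ifs with hq
        · subst hq
          rw [← ht, ← hcount q, ← nsmul_eq_mul, ← Finset.sum_const, Finset.sum_filter]
          refine Finset.sum_congr rfl fun z _ => ?_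
          split_ifs <;> simp [hts]
        · refine Finset.sum_eq_zero fun z _ => ?_
          by_cases h1 : HasLabel π (z, q.2) q.1
          · have h2 : ¬ HasLabel π (z, q'.2) q'.1 := fun h2 => hq (hP z q q' h1 h2)
            simp [h2]
          · simp [h1] }
  have henc : ∀ ψ p, C.encode ψ p = if h : p ∈ extendedDual H then
      EAQECC.ebitScale 1 * t * ψ (π ⟨p, h⟩) else 0 := by
    rintro ψ ⟨z, b⟩
    rw [EAQECC.encode_apply]
    split_ifs with h
    · rw [Finset.sum_eq_single (π ⟨(z, b), h⟩)]
      · have : HasLabel π (z, b) (π ⟨(z, b), h⟩) := ⟨h, rfl⟩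
        simp only [C, Matrix.of_apply, this, if_true]
        ring
      · intro w _ hw
        have : ¬ HasLabel π (z, b) w := fun h1 => hw h1.2.symm
        simp [C, this]
      · simp
    · have : ∀ w, ¬ HasLabel π (z, b) w := fun w h1 => h h1.1
      simp [C, this]
  refine ⟨k, 1, C, fun _ => pauliXZ 1 0, fun _ => pauliXZ 0 1, fun _ => ⟨0, 1, 0, by simp⟩,
    fun _ => ⟨0, 0, 1, by simp⟩, fun φ => ⟨?_, fun hφ => ?_⟩⟩
  · rintro ⟨ψ, rfl⟩ i
    constructor
    · ext p
      rw [pauliXZ_kronecker_mulVec]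
      simp only [zero_dotProduct, add_zero, bitSign_zero, one_mul, henc]
      by_cases h : p ∈ extendedDual H
      · have h1 := (extendedDual H).add_mem h (hLle (hrow i))
        have h2 := (hker ⟨_, hLle (hrow i)⟩).2 (hrow i)
        have h3 := π.map_add ⟨p, h⟩ ⟨_, hLle (hrow i)⟩
        rw [h2, add_zero] at h3
        rw [dif_pos h, dif_pos h1, ← h3]
        rfl
      · have h1 : p + (H i, 1) ∉ extendedDual H := fun h1 => h (by
          have := (extendedDual H).sub_mem h1 (hLle (hrow i))
          rwa [add_sub_cancel_right] at this)
        rw [dif_neg h, dif_neg h1]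
    · ext p
      rw [pauliXZ_kronecker_mulVec]
      have h0 : p + ((0 : Bits N), (0 : Bits (Fin 1))) = p := add_zero p
      rw [h0, add_zero, add_zero, henc]
      split_ifs with h
      · rw [h i, bitSign_zero, one_mul]
      · rw [mul_zero]
  -- The X-generators force `φ` to be constant on cosets of the extended row space; below, the
  -- Z-generators force its support into the dual.
  · have htrans : ∀ l ∈ extendedRowSpace H, ∀ p, φ (p + l) = φ p := by
      intro l hl
      induction hl using Submodule.span_induction with
      | mem x hx =>
        obtain ⟨i, rfl⟩ := hx
        intro p
        have h1 := congrFun (hφ i).1 p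
        rw [pauliXZ_kronecker_mulVec] at h1
        simpa [bitSign_zero] using h1
      | zero => simp
      | add x y _ _ hx hy =>
        intro p
        rw [← add_assoc, hy, hx]
      | smul a x _ hx =>
        intro p
        obtain rfl | rfl := zmod_two_eq_zero_or_one a
        · rw [zero_smul, add_zero]
        · rw [one_smul, hx]
    obtain ⟨σ, hσ⟩ := hπ.hasRightInverse
    -- The logical amplitudes are read off at coset representatives, undoing the normalisation.
    refine ⟨fun w => (EAQECC.ebitScale 1 * t)⁻¹ * φ (σ w), ?_⟩
    ext p
    rw [henc]
    split_ifs with h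
    · rw [mul_inv_cancel_left₀ (mul_ne_zero (EAQECC.ebitScale_ne_zero 1) ht0)]
      have h1 : π (σ (π ⟨p, h⟩) - ⟨p, h⟩) = 0 := by
        rw [map_sub, hσ, sub_self]
      rw [← htrans _ ((hker _).1 h1) p]
      simp
    · by_contra hne
      apply h
      intro i
      have h1 := congrFun (hφ i).2 p
      rw [pauliXZ_kronecker_mulVec] at h1
      have h0 : p + ((0 : Bits N), (0 : Bits (Fin 1))) = p := add_zero p
      rw [h0, add_zero, add_zero] at h1
      exact bitSign_eq_one_iff.1 (mul_right_cancel₀ (Ne.symm hne) (h1.trans (one_mul _).symm))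

end OneEbit

/-! ### The parameters of the code. -/

theorem mainTheorem5 {V B : Type*} [Fintype V] [DecidableEq V] [Fintype B] [DecidableEq B]
    (blocks : B → Finset V) (v μ r : ℕ) (hμ : 2 ≤ μ) (hv : μ < v)
    (hD : IsSteiner2Design blocks μ v)
    (hr : (r : ℝ) = ((v : ℝ) - 1) / ((μ : ℝ) - 1)) (hodd : Odd r) :
    incidenceMatrix blocks * (incidenceMatrix blocks).transpose = Matrix.of (fun _ _ => 1) ∧
    (∀ x : V, hammingNorm (incidenceMatrix blocks x) = r) ∧
    (∀ j : B, hammingNorm ((incidenceMatrix blocks).transpose j) = μ) ∧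
    (tannerGraph (incidenceMatrix blocks)).egirth = 6 ∧
    (∃ (k c : ℕ) (C : EAQECC B k c), C.IsCSSCodeOf (incidenceMatrix blocks)) ∧
    ∀ (k c : ℕ) (C : EAQECC B k c), C.IsCSSCodeOf (incidenceMatrix blocks) →
      (C.length : ℝ) = (v : ℝ) * ((v : ℝ) - 1) / ((μ : ℝ) * ((μ : ℝ) - 1)) ∧
      (v : ℝ) * r / μ - 2 * v + 1 ≤ k ∧
      (k : ℝ) ≤ (v : ℝ) * r / μ
        - 2 * (⌈(1 / 2 : ℝ) + Real.sqrt (1 / 4 + ((v : ℝ) - 1) * ((v : ℝ) - μ) / μ)⌉ : ℝ) + 1 ∧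
      c = 1 := by
  have hμR : (2 : ℝ) ≤ μ := by exact_mod_cast hμ
  have hμ1 : (μ : ℝ) - 1 ≠ 0 := by linarith
  have hμ0 : (μ : ℝ) ≠ 0 := by linarith
  have hrμ : (r : ℝ) * ((μ : ℝ) - 1) = v - 1 := by
    rw [hr, div_mul_cancel₀ _ hμ1]
  have hrep : ∀ x, (Finset.univ.filter fun j => x ∈ blocks j).card = r := by
    intro x
    have h1 : ((Finset.univ.filter fun j => x ∈ blocks j).card : ℝ) * ((μ : ℝ) - 1) = v - 1 := by
      have := hD.card_through_mul x
      rw [← Nat.cast_pred (by omega), ← Nat.cast_pred (by omega), ← this, Nat.cast_mul]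
    exact_mod_cast mul_right_cancel₀ hμ1 (h1.trans hrμ.symm)
  have hJ := hD.incidenceMatrix_mul_transpose hrep hodd
  have hdot : ∀ x y, incidenceMatrix blocks x ⬝ᵥ incidenceMatrix blocks y = 1 :=
    fun x y => congrFun (congrFun hJ x) y
  have : Nonempty V := Fintype.card_pos_iff.1 (by rw [hD.card_points]; omega)
  have hbμ := hD.card_blocks_mul hrep
  have : Nonempty B := Fintype.card_pos_iff.1 (Nat.pos_of_ne_zero fun h => by
    rw [h, zero_mul] at hbμ
    exact (Nat.mul_pos (by omega : 0 < v) hodd.pos).ne hbμ)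
  have hb : (Fintype.card B : ℝ) = v * r / μ := by
    rw [eq_div_iff hμ0]; exact_mod_cast hbμ
  refine ⟨hJ, fun x => by rw [hammingNorm_incidenceMatrix_row, hrep],
    fun j => by rw [hammingNorm_incidenceMatrix_column, hD.card_block],
    hD.egirth_tannerGraph hμ hv, exists_isCSSCodeOf hdot, ?_⟩
  rintro k c C ⟨gX, gZ, hX, hZ, hC⟩
  have hS : C.IsStabilizedBy (incidenceMatrix blocks) gX gZ := hC
  obtain rfl := hS.ebits_eq_one hX hZ hdot
  have hk := hS.add_two_mul_rank
  obtain ⟨hd1, hd⟩ := hD.card_flags_le_rank hrep hodd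
  have hdv : (incidenceMatrix blocks).rank ≤ v := hD.card_points ▸ Matrix.rank_le_card_height _
  generalize (incidenceMatrix blocks).rank = d at *
  have hkR : (k : ℝ) + 2 * d = v * r / μ + 1 := by
    rw [← hb]; exact_mod_cast hk
  refine ⟨?_, ?_, ?_, rfl⟩
  · rw [EAQECC.length, hb, hr, mul_div_assoc', div_div, mul_comm ((μ : ℝ) - 1)]
  · have : (d : ℝ) ≤ v := by exact_mod_cast hdv
    linarith
  · have hdR : (1 : ℝ) ≤ d := by exact_mod_cast hd1
    have hcyc : (v : ℝ) * r + 1 ≤ (d - 1) * d + (v + v * r / μ) := by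
      rw [hbμ, hD.card_points] at hd
      have : ((v * r + 1 : ℕ) : ℝ) ≤ (((d - 1) * d + (v + Fintype.card B) : ℕ) : ℝ) := by
        exact_mod_cast hd
      push_cast [Nat.cast_sub hd1] at this
      rwa [hb] at this
    -- The cyclomatic number of the incidence graph in closed form, from `r(μ - 1) = v - 1`.
    have hform : (v : ℝ) * r + 1 - v - v * r / μ = (v - 1) * (v - μ) / μ := by
      field_simp
      linear_combination (v : ℝ) * hrμ
    -- Completing the square in `d(d - 1)`; taking the root needs `d - 1/2 ≥ 0`, supplied by `1 ≤
    -- d`.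
    have hsq : Real.sqrt (1 / 4 + ((v : ℝ) - 1) * ((v : ℝ) - μ) / μ) ≤ d - 1 / 2 := by
      rw [Real.sqrt_le_left (by linarith)]
      nlinarith
    have hceil : ⌈(1 / 2 : ℝ) + Real.sqrt (1 / 4 + ((v : ℝ) - 1) * ((v : ℝ) - μ) / μ)⌉ ≤ (d : ℤ) :=
      Int.ceil_le.2 (by push_cast; linarith)
    have : (⌈(1 / 2 : ℝ) + Real.sqrt (1 / 4 + ((v : ℝ) - 1) * ((v : ℝ) - μ) / μ)⌉ : ℝ) ≤ d := by
      exact_mod_cast hceil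
    linarith
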